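/- Let $A, B, C$ be real symmetric traceless $3\times 3$ matrices. Let $\|X\| = \left(\sum_{i,j} x_{ij}^2\right)^{1/2}$ denote the Frobenius norm of a matrix $X=(x_{ij})$, and $[X,Y] = XY - YX$ the commutator. Then $$\left(\|A\|^2+\|B\|^2+\|C\|^2\right)^2 \ \ge\ 2\,\|[A,B]\|^2 + 2\,\|[B,C]\|^2 + 2\,\|[C,A]\|^2 .$$ -/

import Mathlib

-- The norm on matrices is the Frobenius norm.
attribute [local instance] Matrix.frobeniusNormedAddCommGroup

/-!
The inequality is proved for arbitrary symmetric real `3 × 3` matrices. Both sides are unchanged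
when an orthogonal matrix mixes the triple `(A, B, C)`, because the right-hand side is the sum of
`‖[Aᵢ, Aⱼ]‖²` over all ordered pairs (`sum_frobInner_lie_mix`). Diagonalizing the Gram matrix of the
triple therefore reduces the claim to pairwise orthogonal matrices (`exists_mix_orthogonal`).

For symmetric `A`, the operator `ad A` satisfies `⟨[A, B], S⟩ = ⟨B, [A, S]⟩`. It yields two bounds,
written for unit vectors:

* `‖[A, B]‖² ≤ 2`, by taking `S = [A, B]`, since a skew-symmetric `3 × 3` matrix acts as the cross
  product with a vector of squared length `‖S‖² / 2` (`frobInner_lie_self_le`);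
* `‖[A, B]‖² + ‖[A, C]‖² ≤ 3` when `B ⊥ C`, by letting `S` run over the standard skew-symmetric
  matrices and using Bessel's inequality (`frobInner_lie_add_le`). This is the trace bound
  `∑_{i<j} (λᵢ - λⱼ)² ≤ 3 ∑ λᵢ²`.

If `a`, `b`, `c` are the squared norms of an orthogonal triple and `k`, `l`, `m` the normalized
squared norms of the commutators, it remains to see that
`2 (k a b + l b c + m c a) ≤ (a + b + c)²` whenever each of `k`, `l`, `m` is at most `2` and each
sum of two of them is at most `3` (`two_mul_sum_le_sq`).
-/

namespace Matrix

/-! ### The Frobenius inner product -/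

/-- The Frobenius inner product `∑ i j, X i j * Y i j`, written as `tr (Xᵀ Y)`. -/
def frobInner {n : Type*} [Fintype n] (X Y : Matrix n n ℝ) : ℝ := (Xᵀ * Y).trace

section

variable {n : Type*} [Fintype n]

lemma frobInner_eq_sum (X Y : Matrix n n ℝ) :
    frobInner X Y = ∑ i, ∑ j, X i j * Y i j := by
  rw [Finset.sum_comm]
  simp [frobInner, trace, mul_apply]

lemma norm_sq_eq_frobInner (X : Matrix n n ℝ) : ‖X‖ ^ 2 = frobInner X X := by
  have h : 0 ≤ ∑ i, ∑ j, ‖X i j‖ ^ (2 : ℝ) := by positivity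
  rw [frobenius_norm_def, ← Real.sqrt_eq_rpow, Real.sq_sqrt h, frobInner_eq_sum]
  simp [sq]

lemma frobInner_self_nonneg (X : Matrix n n ℝ) : 0 ≤ frobInner X X := by
  rw [← norm_sq_eq_frobInner]
  positivity

lemma frobInner_comm (X Y : Matrix n n ℝ) : frobInner X Y = frobInner Y X := by
  simp only [frobInner_eq_sum, mul_comm]

lemma frobInner_add_left (X Y Z : Matrix n n ℝ) :
    frobInner (X + Y) Z = frobInner X Z + frobInner Y Z := by
  simp [frobInner, add_mul]

lemma frobInner_smul_left (c : ℝ) (X Y : Matrix n n ℝ) :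
    frobInner (c • X) Y = c * frobInner X Y := by
  simp [frobInner]

lemma frobInner_add_right (X Y Z : Matrix n n ℝ) :
    frobInner X (Y + Z) = frobInner X Y + frobInner X Z := by
  simp [frobInner, mul_add]

lemma frobInner_smul_right (c : ℝ) (X Y : Matrix n n ℝ) :
    frobInner X (c • Y) = c * frobInner X Y := by
  simp [frobInner]

lemma frobInner_sum_left {ι : Type*} (s : Finset ι) (X : ι → Matrix n n ℝ) (Y : Matrix n n ℝ) :
    frobInner (∑ i ∈ s, X i) Y = ∑ i ∈ s, frobInner (X i) Y := by
  simp [frobInner, transpose_sum, Finset.sum_mul, trace_sum]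

lemma frobInner_sum_right {ι : Type*} (s : Finset ι) (X : Matrix n n ℝ) (Y : ι → Matrix n n ℝ) :
    frobInner X (∑ i ∈ s, Y i) = ∑ i ∈ s, frobInner X (Y i) := by
  simp [frobInner, Finset.mul_sum, trace_sum]

lemma sq_frobInner_le (X Y : Matrix n n ℝ) :
    frobInner X Y ^ 2 ≤ frobInner X X * frobInner Y Y := by
  simp only [frobInner_eq_sum, ← Fintype.sum_prod_type', ← sq]
  exact Finset.sum_mul_sq_le_sq_mul_sq _ _ _

/-- Bessel's inequality for two orthogonal, not necessarily normalized, matrices. -/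
lemma frobInner_bessel {B C : Matrix n n ℝ} (hBC : frobInner B C = 0)
    (hB : 0 < frobInner B B) (hC : 0 < frobInner C C) (T : Matrix n n ℝ) :
    frobInner C C * frobInner B T ^ 2 + frobInner B B * frobInner C T ^ 2 ≤
      frobInner B B * frobInner C C * frobInner T T := by
  -- This is the component of `T` orthogonal to `B` and `C`, with denominators cleared.
  have h := frobInner_self_nonneg ((frobInner B B * frobInner C C) • T +
    ((-(frobInner C C * frobInner B T)) • B + (-(frobInner B B * frobInner C T)) • C))
  simp only [frobInner_add_left, frobInner_add_right, frobInner_smul_left, frobInner_smul_right,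
    hBC, frobInner_comm C B, frobInner_comm T B, frobInner_comm T C] at h
  refine le_of_sub_nonneg (nonneg_of_mul_nonneg_right ?_ (mul_pos hB hC))
  linarith

lemma frobInner_lie_comm (X Y : Matrix n n ℝ) :
    frobInner ⁅Y, X⁆ ⁅Y, X⁆ = frobInner ⁅X, Y⁆ ⁅X, Y⁆ := by
  rw [Ring.lie_def, Ring.lie_def, ← neg_sub (X * Y), frobInner, frobInner, transpose_neg,
    neg_mul_neg]

lemma frobInner_lie_lie_self (X : Matrix n n ℝ) : frobInner ⁅X, X⁆ ⁅X, X⁆ = 0 := by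
  simp [frobInner, Ring.lie_def]

/-- For symmetric `A`, the map `ad A` is self-adjoint. -/
lemma IsSymm.frobInner_lie {A : Matrix n n ℝ} (hA : A.IsSymm) (B S : Matrix n n ℝ) :
    frobInner ⁅A, B⁆ S = frobInner B ⁅A, S⁆ := by
  simp only [frobInner, Ring.lie_def, transpose_sub, transpose_mul, hA.eq, sub_mul, mul_sub,
    trace_sub, Matrix.mul_assoc]
  rw [trace_mul_comm A, Matrix.mul_assoc]

end

/-! ### Commutator bounds for `3 × 3` matrices -/

lemma frobInner_lie_le_of_skew {S : Matrix (Fin 3) (Fin 3) ℝ} (hS : Sᵀ = -S)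
    (A : Matrix (Fin 3) (Fin 3) ℝ) :
    frobInner ⁅A, S⁆ ⁅A, S⁆ ≤ 2 * frobInner S S * frobInner A A := by
  have h (i j : Fin 3) : S j i = -S i j := congrFun (congrFun hS i) j
  have h00 : S 0 0 = 0 := by linarith [h 0 0]
  have h11 : S 1 1 = 0 := by linarith [h 1 1]
  have h22 : S 2 2 = 0 := by linarith [h 2 2]
  -- Up to sign, `S` acts as the cross product with the vector `(z, -y, x)`.
  generalize hx : S 0 1 = x at *
  generalize hy : S 0 2 = y at *
  generalize hz : S 1 2 = z at *
  have h10 : S 1 0 = -x := by rw [h 0 1, hx]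
  have h20 : S 2 0 = -y := by rw [h 0 2, hy]
  have h21 : S 2 1 = -z := by rw [h 1 2, hz]
  have key (p q r : ℝ) : (-q * x - r * y) ^ 2 + (p * x - r * z) ^ 2 + (p * y + q * z) ^ 2 ≤
      (x ^ 2 + y ^ 2 + z ^ 2) * (p ^ 2 + q ^ 2 + r ^ 2) := by
    linarith [sq_nonneg (p * z - q * y + r * x)]
  have par (u v : ℝ) : (u - v) ^ 2 ≤ 2 * u ^ 2 + 2 * v ^ 2 := by linarith [sq_nonneg (u + v)]
  have hsub : frobInner ⁅A, S⁆ ⁅A, S⁆ ≤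
      2 * frobInner (A * S) (A * S) + 2 * frobInner (S * A) (S * A) := by
    simp only [frobInner_eq_sum, Ring.lie_def, sub_apply, ← sq, Finset.mul_sum,
      ← Finset.sum_add_distrib]
    gcongr
    exact par _ _
  have hl : 2 * frobInner (A * S) (A * S) ≤ frobInner S S * frobInner A A := by
    simp only [frobInner_eq_sum, mul_apply, Fin.sum_univ_three, hx, hy, hz, h00, h11, h22,
      h10, h20, h21]
    linarith [key (A 0 0) (A 0 1) (A 0 2), key (A 1 0) (A 1 1) (A 1 2),
      key (A 2 0) (A 2 1) (A 2 2)]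
  have hr : 2 * frobInner (S * A) (S * A) ≤ frobInner S S * frobInner A A := by
    simp only [frobInner_eq_sum, mul_apply, Fin.sum_univ_three, hx, hy, hz, h00, h11, h22,
      h10, h20, h21]
    linarith [key (A 0 0) (A 1 0) (A 2 0), key (A 0 1) (A 1 1) (A 2 1),
      key (A 0 2) (A 1 2) (A 2 2)]
  linarith

lemma frobInner_lie_self_le {A B : Matrix (Fin 3) (Fin 3) ℝ} (hA : A.IsSymm) (hB : B.IsSymm) :
    frobInner ⁅A, B⁆ ⁅A, B⁆ ≤ 2 * frobInner A A * frobInner B B := by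
  have hS : ⁅A, B⁆ᵀ = -⁅A, B⁆ := by
    simp [Ring.lie_def, transpose_mul, hA.eq, hB.eq]
  have h1 := frobInner_lie_le_of_skew hS A
  have h2 := sq_frobInner_le B ⁅A, ⁅A, B⁆⁆
  rw [← hA.frobInner_lie] at h2
  have hB0 := frobInner_self_nonneg B
  have hA0 := frobInner_self_nonneg A
  rcases (frobInner_self_nonneg ⁅A, B⁆).eq_or_lt with h0 | h0
  · rw [← h0]
    positivity
  · refine le_of_mul_le_mul_right ?_ h0
    linarith [mul_le_mul_of_nonneg_left h1 hB0]

lemma frobInner_lie_add_le {A B C : Matrix (Fin 3) (Fin 3) ℝ} (hA : A.IsSymm)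
    (hBC : frobInner B C = 0) (hB : 0 < frobInner B B) (hC : 0 < frobInner C C)
    (hBs : B.IsSymm) (hCs : C.IsSymm) :
    frobInner C C * frobInner ⁅A, B⁆ ⁅A, B⁆ + frobInner B B * frobInner ⁅A, C⁆ ⁅A, C⁆ ≤
      3 * frobInner A A * frobInner B B * frobInner C C := by
  let S (i j : Fin 3) : Matrix (Fin 3) (Fin 3) ℝ := single i j 1 - single j i 1
  have expand {X : Matrix (Fin 3) (Fin 3) ℝ} (hX : X.IsSymm) : 2 * frobInner ⁅A, X⁆ ⁅A, X⁆ =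
      frobInner X ⁅A, S 0 1⁆ ^ 2 + frobInner X ⁅A, S 0 2⁆ ^ 2 + frobInner X ⁅A, S 1 2⁆ ^ 2 := by
    have hs (i j : Fin 3) : ⁅A, X⁆ j i = -⁅A, X⁆ i j := by
      have : ⁅A, X⁆ᵀ = -⁅A, X⁆ := by simp [Ring.lie_def, transpose_mul, hA.eq, hX.eq]
      exact congrFun (congrFun this i) j
    have hp (i j : Fin 3) : frobInner X ⁅A, S i j⁆ = 2 * ⁅A, X⁆ i j := by
      rw [← hA.frobInner_lie]
      simp only [S, frobInner, mul_sub, trace_sub, trace_mul_single, transpose_apply]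
      simp [hs i j]
      ring
    have h00 : ⁅A, X⁆ 0 0 = 0 := by linarith [hs 0 0]
    have h11 : ⁅A, X⁆ 1 1 = 0 := by linarith [hs 1 1]
    have h22 : ⁅A, X⁆ 2 2 = 0 := by linarith [hs 2 2]
    rw [hp, hp, hp, frobInner_eq_sum]
    simp only [Fin.sum_univ_three, h00, h11, h22, hs 0 1, hs 0 2, hs 1 2]
    ring
  -- The Casimir operator `∑ (ad S)²` acts on traceless symmetric matrices as a scalar.
  have casimir : frobInner ⁅A, S 0 1⁆ ⁅A, S 0 1⁆ + frobInner ⁅A, S 0 2⁆ ⁅A, S 0 2⁆ +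
      frobInner ⁅A, S 1 2⁆ ⁅A, S 1 2⁆ = 6 * frobInner A A - 2 * A.trace ^ 2 := by
    have h10 : A 1 0 = A 0 1 := hA.apply 0 1
    have h20 : A 2 0 = A 0 2 := hA.apply 0 2
    have h21 : A 2 1 = A 1 2 := hA.apply 1 2
    simp [S, frobInner_eq_sum, Ring.lie_def, mul_apply, Fin.sum_univ_three, single_apply,
      trace_fin_three, h10, h20, h21]
    ring
  have b1 := frobInner_bessel hBC hB hC ⁅A, S 0 1⁆
  have b2 := frobInner_bessel hBC hB hC ⁅A, S 0 2⁆
  have b3 := frobInner_bessel hBC hB hC ⁅A, S 1 2⁆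
  have eB := congrArg (frobInner C C * ·) (expand hBs)
  have eC := congrArg (frobInner B B * ·) (expand hCs)
  have ec := congrArg (frobInner B B * frobInner C C * ·) casimir
  have ht : 0 ≤ frobInner B B * frobInner C C * A.trace ^ 2 := by positivity
  beta_reduce at eB eC ec
  linarith

/-! ### Mixing a family by an orthogonal matrix -/

/-- The family `i ↦ ∑ j, U j i • A j` obtained by combining the matrices `A j` with
the coefficients in column `i` of `U`. -/
def mix (U : Matrix (Fin 3) (Fin 3) ℝ) (A : Fin 3 → Matrix (Fin 3) (Fin 3) ℝ) (i : Fin 3) :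
    Matrix (Fin 3) (Fin 3) ℝ := ∑ j, U j i • A j

lemma frobInner_mix (U : Matrix (Fin 3) (Fin 3) ℝ) (A : Fin 3 → Matrix (Fin 3) (Fin 3) ℝ)
    (i k : Fin 3) :
    frobInner (mix U A i) (mix U A k) =
      (Uᵀ * of (fun i j ↦ frobInner (A i) (A j)) * U) i k := by
  simp only [mix, frobInner_sum_left, frobInner_sum_right, frobInner_smul_left,
    frobInner_smul_right, mul_apply, transpose_apply, of_apply, Finset.sum_mul, Finset.mul_sum]
  refine Finset.sum_congr rfl fun j _ ↦ Finset.sum_congr rfl fun l _ ↦ by ring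

lemma sum_frobInner_mix {U : Matrix (Fin 3) (Fin 3) ℝ} (hU : U * Uᵀ = 1)
    (A : Fin 3 → Matrix (Fin 3) (Fin 3) ℝ) :
    ∑ i, frobInner (mix U A i) (mix U A i) = ∑ i, frobInner (A i) (A i) := by
  simp only [frobInner_mix]
  change trace _ = _
  rw [trace_mul_comm, ← Matrix.mul_assoc, hU, Matrix.one_mul]
  rfl

lemma sum_frobInner_lie_mix {U : Matrix (Fin 3) (Fin 3) ℝ} (hU : U * Uᵀ = 1)
    (A : Fin 3 → Matrix (Fin 3) (Fin 3) ℝ) :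
    ∑ i, ∑ j, frobInner ⁅mix U A i, mix U A j⁆ ⁅mix U A i, mix U A j⁆ =
      ∑ i, ∑ j, frobInner ⁅A i, A j⁆ ⁅A i, A j⁆ := by
  have hr (X : Matrix (Fin 3) (Fin 3) ℝ) (j : Fin 3) :
      ⁅X, mix U A j⁆ = mix U (fun l ↦ ⁅X, A l⁆) j := by
    simp [mix, Ring.lie_def, Finset.mul_sum, Finset.sum_mul, smul_sub]
  have hl (X : Matrix (Fin 3) (Fin 3) ℝ) (i : Fin 3) :
      ⁅mix U A i, X⁆ = mix U (fun l ↦ ⁅A l, X⁆) i := by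
    simp [mix, Ring.lie_def, Finset.mul_sum, Finset.sum_mul, smul_sub]
  simp only [hr, sum_frobInner_mix hU]
  rw [Finset.sum_comm]
  simp only [hl, sum_frobInner_mix hU]
  rw [Finset.sum_comm]

lemma isSymm_mix (U : Matrix (Fin 3) (Fin 3) ℝ) {A : Fin 3 → Matrix (Fin 3) (Fin 3) ℝ}
    (hA : ∀ i, (A i).IsSymm) (i : Fin 3) : (mix U A i).IsSymm := by
  simp [IsSymm, mix, transpose_sum, (hA _).eq]

/-- Diagonalizing the Gram matrix of a family makes the family pairwise orthogonal. -/
lemma exists_mix_orthogonal (A : Fin 3 → Matrix (Fin 3) (Fin 3) ℝ) :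
    ∃ U : Matrix (Fin 3) (Fin 3) ℝ, U * Uᵀ = 1 ∧
      ∀ i j, i ≠ j → frobInner (mix U A i) (mix U A j) = 0 := by
  have hG : (of fun i j ↦ frobInner (A i) (A j)).IsHermitian := by
    ext i j
    simp [frobInner_comm (A j)]
  refine ⟨hG.eigenvectorUnitary, ?_, fun i j hij ↦ ?_⟩
  · have := Unitary.coe_mul_star_self hG.eigenvectorUnitary
    rwa [Unitary.coe_star, star_eq_conjTranspose, conjTranspose_eq_transpose_of_trivial] at this
  · have := hG.conjStarAlgAut_star_eigenvectorUnitary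
    rw [Unitary.conjStarAlgAut_apply] at this
    simp only [Unitary.coe_star, star_eq_conjTranspose, conjTranspose_eq_transpose_of_trivial,
      transpose_transpose] at this
    rw [frobInner_mix, this, diagonal_apply_ne _ hij]

/-! ### The inequality for orthogonal triples -/

/-- The quadratic form `(a + b + c)² - 2 (k a b + l b c + m c a)` is copositive when each of `k`,
`l`, `m` is at most `2` and each sum of two of them is at most `3`. -/
lemma two_mul_sum_le_sq {a b c k l m : ℝ} (ha : 0 ≤ a) (hb : 0 ≤ b) (hc : 0 ≤ c)
    (hk : k ≤ 2) (hl : l ≤ 2) (hm : m ≤ 2) (hkl : k + l ≤ 3) (hlm : l + m ≤ 3)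
    (hmk : m + k ≤ 3) :
    2 * (k * (a * b) + l * (b * c) + m * (c * a)) ≤ (a + b + c) ^ 2 := by
  have hab := mul_nonneg ha hb
  have hbc := mul_nonneg hb hc
  have hca := mul_nonneg hc ha
  -- If `k` exceeds `3 / 2`, then `l` and `m` can be raised to `3 - k`, and the form becomes
  -- `(k - 1) (a - b)² + (2 - k) ((a - c)² + (b - c)²) + (2 k - 3) c²`.
  have main {a b c k l m : ℝ} (hab : 0 ≤ a * b) (hbc : 0 ≤ b * c) (hca : 0 ≤ c * a)
      (hk : k ≤ 2) (hkl : k + l ≤ 3) (hmk : m + k ≤ 3) (h : 3 / 2 ≤ k) :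
      2 * (k * (a * b) + l * (b * c) + m * (c * a)) ≤ (a + b + c) ^ 2 := by
    have h1 : l * (b * c) ≤ (3 - k) * (b * c) := by gcongr; linarith
    have h2 : m * (c * a) ≤ (3 - k) * (c * a) := by gcongr; linarith
    have h3 : 0 ≤ (k - 1) * (a - b) ^ 2 := mul_nonneg (by linarith) (sq_nonneg _)
    have h4 : 0 ≤ (2 - k) * ((a - c) ^ 2 + (b - c) ^ 2) := mul_nonneg (by linarith) (by positivity)
    have h5 : 0 ≤ (2 * k - 3) * c ^ 2 := mul_nonneg (by linarith) (sq_nonneg _)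
    linarith
  rcases le_total (3 / 2) k with h | h
  · exact main hab hbc hca hk hkl hmk h
  rcases le_total (3 / 2) l with h' | h'
  · linarith [main hbc hca hab hl hlm hkl h']
  rcases le_total (3 / 2) m with h'' | h''
  · linarith [main hca hab hbc hm hmk hlm h'']
  have h1 : k * (a * b) ≤ 3 / 2 * (a * b) := by gcongr
  have h2 : l * (b * c) ≤ 3 / 2 * (b * c) := by gcongr
  have h3 : m * (c * a) ≤ 3 / 2 * (c * a) := by gcongr
  linarith [sq_nonneg (a - b), sq_nonneg (b - c), sq_nonneg (c - a)]

lemma two_mul_sum_frobInner_lie_le_of_orthogonal {A B C : Matrix (Fin 3) (Fin 3) ℝ}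
    (hA : A.IsSymm) (hB : B.IsSymm) (hC : C.IsSymm)
    (hAB : frobInner A B = 0) (hBC : frobInner B C = 0) (hCA : frobInner C A = 0) :
    2 * (frobInner ⁅A, B⁆ ⁅A, B⁆ + frobInner ⁅B, C⁆ ⁅B, C⁆ + frobInner ⁅C, A⁆ ⁅C, A⁆) ≤
      (frobInner A A + frobInner B B + frobInner C C) ^ 2 := by
  have k := frobInner_lie_self_le hA hB
  have l := frobInner_lie_self_le hB hC
  have m := frobInner_lie_self_le hC hA
  have ha := frobInner_self_nonneg A
  have hb := frobInner_self_nonneg B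
  have hc := frobInner_self_nonneg C
  have sq (x y : ℝ) : 4 * (x * y) ≤ (x + y) ^ 2 := by linarith [sq_nonneg (x - y)]
  -- When one of the matrices vanishes, only one commutator survives.
  rcases ha.eq_or_lt with h | ha'
  · rw [← h] at k m ⊢
    linarith [sq (frobInner B B) (frobInner C C)]
  rcases hb.eq_or_lt with h | hb'
  · rw [← h] at k l ⊢
    linarith [sq (frobInner A A) (frobInner C C)]
  rcases hc.eq_or_lt with h | hc'
  · rw [← h] at l m ⊢
    linarith [sq (frobInner A A) (frobInner B B)]
  have mk := frobInner_lie_add_le hA hBC hb' hc' hB hC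
  have kl := frobInner_lie_add_le hB hCA hc' ha' hC hA
  have lm := frobInner_lie_add_le hC hAB ha' hb' hA hB
  rw [frobInner_lie_comm C A] at mk
  rw [frobInner_lie_comm A B] at kl
  rw [frobInner_lie_comm B C] at lm
  generalize frobInner A A = a at *
  generalize frobInner B B = b at *
  generalize frobInner C C = c at *
  generalize frobInner ⁅A, B⁆ ⁅A, B⁆ = K at *
  generalize frobInner ⁅B, C⁆ ⁅B, C⁆ = L at *
  generalize frobInner ⁅C, A⁆ ⁅C, A⁆ = M at *
  have main := two_mul_sum_le_sq (k := K / (a * b)) (l := L / (b * c)) (m := M / (c * a)) ha hb hc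
    (by rw [div_le_iff₀ (by positivity)]; linarith)
    (by rw [div_le_iff₀ (by positivity)]; linarith)
    (by rw [div_le_iff₀ (by positivity)]; linarith)
    (by
      rw [show K / (a * b) + L / (b * c) = (a * L + c * K) / (a * b * c) by field_simp; ring,
        div_le_iff₀ (by positivity)]
      linarith)
    (by
      rw [show L / (b * c) + M / (c * a) = (a * L + b * M) / (a * b * c) by field_simp,
        div_le_iff₀ (by positivity)]
      linarith)
    (by
      rw [show M / (c * a) + K / (a * b) = (b * M + c * K) / (a * b * c) by field_simp,
        div_le_iff₀ (by positivity)]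
      linarith)
  rwa [div_mul_cancel₀ _ (by positivity), div_mul_cancel₀ _ (by positivity),
    div_mul_cancel₀ _ (by positivity)] at main

/-! ### The general case -/

lemma sum_frobInner_lie_le (A : Fin 3 → Matrix (Fin 3) (Fin 3) ℝ) (hA : ∀ i, (A i).IsSymm) :
    ∑ i, ∑ j, frobInner ⁅A i, A j⁆ ⁅A i, A j⁆ ≤ (∑ i, frobInner (A i) (A i)) ^ 2 := by
  obtain ⟨U, hU, horth⟩ := exists_mix_orthogonal A
  have hs := isSymm_mix U hA
  rw [← sum_frobInner_lie_mix hU, ← sum_frobInner_mix hU]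
  generalize mix U A = B at *
  have h := two_mul_sum_frobInner_lie_le_of_orthogonal (hs 0) (hs 1) (hs 2)
    (horth 0 1 (by decide)) (horth 1 2 (by decide)) (horth 2 0 (by decide))
  simp only [Fin.sum_univ_three, frobInner_lie_lie_self, frobInner_lie_comm (B 0) (B 1),
    frobInner_lie_comm (B 1) (B 2), frobInner_lie_comm (B 2) (B 0)]
  linarith

end Matrix

theorem mainTheorem4 (A B C : Matrix (Fin 3) (Fin 3) ℝ)
    (hA : A.IsSymm) (hB : B.IsSymm) (hC : C.IsSymm)
    (hA0 : A.trace = 0) (hB0 : B.trace = 0) (hC0 : C.trace = 0) :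
    (‖A‖ ^ 2 + ‖B‖ ^ 2 + ‖C‖ ^ 2) ^ 2 ≥
      2 * ‖⁅A, B⁆‖ ^ 2 + 2 * ‖⁅B, C⁆‖ ^ 2 + 2 * ‖⁅C, A⁆‖ ^ 2 := by
  have h := Matrix.sum_frobInner_lie_le ![A, B, C] (by intro i; fin_cases i <;> assumption)
  simp only [Fin.sum_univ_three, Matrix.cons_val, Matrix.frobInner_lie_lie_self,
    Matrix.frobInner_lie_comm A B, Matrix.frobInner_lie_comm B C,
    Matrix.frobInner_lie_comm C A] at h
  simp only [Matrix.norm_sq_eq_frobInner]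
  linarith
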